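/- Let $d\ge 2$, let $q_1,\dots,q_d$ be pairwise coprime positive integers, $Q=q_1\cdots q_d$ and $\Gamma=q_1\mathbb Z\oplus\cdots\oplus q_d\mathbb Z$. For a $\Gamma$-periodic function $V$ on $\mathbb Z^d$ and $k\in\mathbb R^d$, let $D_V(k)$ be the $Q\times Q$ matrix of the operator $(\Delta u)(n)+V(n)u(n)$, where $(\Delta u)(n)=\sum_{\|n'-n\|_1=1}u(n')$, acting on the functions $u:\mathbb Z^d\to\mathbb C$ with $u(n+q_j\mathbf e_j)=e^{2\pi \mathbf i k_j}u(n)$ for all $n\in\mathbb Z^d$ and $1\le j\le d$ (identified with their values on the cell $\{n: 0\le n_j\le q_j-1\}$), and let $P_V(k,\lambda)=\det(D_V(k)-\lambda I)$. For a non-empty set $S\subset\{1,\dots,d\}$, two $\Gamma$-periodic functions $V$ and $Y$ are called partially Fermi isospectral with respect to $S$ if there exist $\lambda\in\mathbb C$ and real numbers $k_j^*$, $j\notin S$, such that $P_V(k,\lambda)=P_Y(k,\lambda)$ for all $k\in\mathbb R^d$ with $k_j=k_j^*$ for every $j\notin S$. Let $V:\mathbb Z^d\to\mathbb R$ be $\Gamma$-periodic.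 Suppose that for all $1\le s<t\le d$ there exists $S=S(s,t)\subset\{1,\dots,d\}$ with $s,t\in S$ and $\#S\ge 3$ such that $V$ and the zero potential are partially Fermi isospectral with respect to $S$ (where $\lambda$ and the $k_j^*$ may depend on $s,t$). Then $V\equiv 0$. -/

import Mathlib

/-- `V : ℤ^d → ℝ` is `Γ`-periodic, where `Γ = q₁ℤ ⊕ ⋯ ⊕ q_dℤ`. -/
def IsGammaPeriodic {d : ℕ} (q : Fin d → ℕ) (V : (Fin d → ℤ) → ℝ) : Prop :=
  ∀ (n : Fin d → ℤ) (j : Fin d), V (n + Pi.single j (q j : ℤ)) = V n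

/-- The discrete Laplacian on `ℤ^d`: the sum of `u` over the `2d` nearest neighbours of `n`,
that is, over the points at `ℓ¹`-distance one from `n`. -/
def discreteLaplacian {d : ℕ} (u : (Fin d → ℤ) → ℂ) (n : Fin d → ℤ) : ℂ :=
  ∑ j : Fin d, (u (n + Pi.single j 1) + u (n - Pi.single j 1))

/-- The discrete Schrödinger operator `Δ + V`. -/
def discreteSchrodinger {d : ℕ} (V u : (Fin d → ℤ) → ℂ) (n : Fin d → ℤ) : ℂ :=
  discreteLaplacian u n + V n * u n

/-- The representative in the fundamental cell `W = ∏ⱼ {0, …, qⱼ - 1}` of a class in `ℤ^d / Γ`. -/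
def cellRep {d : ℕ} (q : Fin d → ℕ) (x : (j : Fin d) → ZMod (q j)) : Fin d → ℤ :=
  fun j => ((x j).val : ℤ)

/-- The unique function `u` on `ℤ^d` which equals `f` on the cell `W` (identified with `ℤ^d / Γ`)
and satisfies the Floquet-Bloch boundary condition `u (n + qⱼ eⱼ) = exp (2πi kⱼ) u n`.
Here `n j / q j` is division with remainder, so that `n j = q j * (n j / q j) + r` with
`0 ≤ r < q j`. -/
noncomputable def floquetExtension {d : ℕ} (q : Fin d → ℕ) (k : Fin d → ℝ)
    (f : ((j : Fin d) → ZMod (q j)) → ℂ) (n : Fin d → ℤ) : ℂ :=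
  Complex.exp (2 * (Real.pi : ℂ) * Complex.I *
      ∑ j : Fin d, (k j : ℂ) * ((n j / (q j : ℤ) : ℤ) : ℂ)) *
    f (fun j => (n j : ZMod (q j)))

/-- The `Q × Q` matrix `D_V(k)`, `Q = q₁ ⋯ q_d`, of `Δ + V` acting on the functions that satisfy
the Floquet-Bloch boundary condition with quasimomentum `k`, such functions being identified with
their values on `W`. -/
noncomputable def floquetMatrix {d : ℕ} (q : Fin d → ℕ) (V : (Fin d → ℤ) → ℂ) (k : Fin d → ℝ) :
    Matrix ((j : Fin d) → ZMod (q j)) ((j : Fin d) → ZMod (q j)) ℂ :=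
  Matrix.of fun x y =>
    discreteSchrodinger V (floquetExtension q k (Pi.single y 1)) (cellRep q x)

/-- `P_V(k, l) = det (D_V(k) - l I)`. -/
noncomputable def floquetDet {d : ℕ} (q : Fin d → ℕ) [∀ j, NeZero (q j)]
    (V : (Fin d → ℤ) → ℂ) (k : Fin d → ℝ) (l : ℂ) : ℂ :=
  (floquetMatrix q V k - l • (1 : Matrix _ _ ℂ)).det

/-- `V` and `Y` are generalized partially Fermi isospectral with respect to `S`, `l₁`, `l₂`:
for some fixed real values of the `kⱼ` with `j ∉ S`, one has `P_V(k, l₁) = P_Y(k, l₂)` for all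
real values of the `kⱼ` with `j ∈ S`. Only the values of `kstar` outside `S` matter. -/
def GeneralizedPartiallyFermiIsospectral {d : ℕ} (q : Fin d → ℕ) [∀ j, NeZero (q j)]
    (V Y : (Fin d → ℤ) → ℂ) (S : Finset (Fin d)) (l₁ l₂ : ℂ) : Prop :=
  S.Nonempty ∧ ∃ kstar : Fin d → ℝ, ∀ k : Fin d → ℝ, (∀ j, j ∉ S → k j = kstar j) →
    floquetDet q V k l₁ = floquetDet q Y k l₂

/-- `V` and `Y` are partially Fermi isospectral with respect to `S`: the case `l₁ = l₂`. -/
def PartiallyFermiIsospectral {d : ℕ} (q : Fin d → ℕ) [∀ j, NeZero (q j)]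
    (V Y : (Fin d → ℤ) → ℂ) (S : Finset (Fin d)) : Prop :=
  ∃ l : ℂ, GeneralizedPartiallyFermiIsospectral q V Y S l l

/-! In the basis of plane waves times characters of `∏ⱼ ZMod (q j)`, the Laplacian is diagonal with
symbol `∑ⱼ (zⱼ χ(lⱼ) + zⱼ⁻¹ χ(-lⱼ))`, and `V` becomes a Hermitian matrix with constant diagonal
whose row 0 consists of the Fourier coefficients of `V` (`floquetDet_eq`). The determinant identity
extends from real quasimomenta to all nonzero complex `zⱼ`, `j ∈ S` (`symbolDet_eq_of_real`).

Let `z = tα + sβ + γ` with `t → ∞`. Symbols with `∑ⱼ αⱼ χ(lⱼ) ≠ 0` grow linearly. If `∑ⱼ βⱼ χ(lⱼ) =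
1` at all the others, the rescaled determinant tends to the minor on those indices, shifted by `s`,
times a nonzero constant. Comparison with the zero potential for all `s` equates the traces and the
traces of squares, which kills the corresponding block of `V` (`eq_zero_of_det_add_scalar`,
`potentialMatrix_apply_eq_zero_of_direction`).

It remains to find, for each `l`, such `α` and `β` with both 0 and `l` in the bounded block. Three
directions in `S` suffice, because coprimality and the geometry of the unit circle control that
block (`eq_zero_or_eq_of_collinear`). -/

open Matrix in
/-- The character table of `∏ⱼ ZMod (q j)`. -/
noncomputable def characterMatrix {d : ℕ} (q : Fin d → ℕ) [∀ j, NeZero (q j)] :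
    Matrix ((j : Fin d) → ZMod (q j)) ((j : Fin d) → ZMod (q j)) ℂ :=
  of fun x l => ∏ j, ZMod.stdAddChar (x j * l j)

/-! ### Characters of the finite quotient and Fourier coefficients of the potential -/

section CharacterMatrix

open Matrix

variable {d : ℕ} (q : Fin d → ℕ) [∀ j, NeZero (q j)]

theorem star_stdAddChar {N : ℕ} [NeZero N] (a : ZMod N) :
    star (ZMod.stdAddChar a) = ZMod.stdAddChar (-a) :=
  (AddChar.map_neg_eq_conj _ _).symm

theorem stdAddChar_mul_neg_self {N : ℕ} [NeZero N] (a : ZMod N) :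
    ZMod.stdAddChar a * ZMod.stdAddChar (-a) = (1 : ℂ) := by
  rw [← AddChar.map_add_eq_mul, add_neg_cancel, AddChar.map_zero_eq_one]

theorem characterMatrix_apply (x l : (j : Fin d) → ZMod (q j)) :
    characterMatrix q x l = ∏ j, ZMod.stdAddChar (x j * l j) := rfl

theorem prod_cast_ne_zero : (∏ j, (q j : ℂ)) ≠ 0 :=
  Finset.prod_ne_zero_iff.2 fun j _ => Nat.cast_ne_zero.2 (NeZero.ne (q j))

theorem characterMatrix_mul_conjTranspose :
    characterMatrix q * (characterMatrix q)ᴴ = (∏ j, (q j : ℂ)) • 1 := by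
  ext x y
  simp only [mul_apply, conjTranspose_apply, characterMatrix_apply, Matrix.smul_apply, one_apply,
    star_prod, star_stdAddChar, ← Finset.prod_mul_distrib, ← AddChar.map_add_eq_mul]
  have h : ∀ j, ∑ a : ZMod (q j), (ZMod.stdAddChar (x j * a + -(y j * a)) : ℂ) =
      if x j = y j then (q j : ℂ) else 0 := by
    intro j
    have := AddChar.sum_mulShift (x j - y j) (ZMod.isPrimitive_stdAddChar (q j))
    rw [ZMod.card] at this
    simp only [sub_eq_zero] at this
    rw [apply_ite Nat.cast, Nat.cast_zero] at this
    rw [← this]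
    refine Finset.sum_congr rfl fun a _ => ?_
    congr 1; ring
  rw [← Fintype.prod_sum fun j (a : ZMod (q j)) =>
    (ZMod.stdAddChar (x j * a + -(y j * a)) : ℂ)]
  simp only [h]
  by_cases hxy : x = y
  · simp [hxy]
  · obtain ⟨j, hj⟩ := Function.ne_iff.1 hxy
    rw [Finset.prod_eq_zero (Finset.mem_univ j) (by simp [hj])]
    simp [hxy]

theorem characterMatrix_det_ne_zero : (characterMatrix q).det ≠ 0 := by
  intro h
  have := congrArg det (characterMatrix_mul_conjTranspose q)
  rw [det_mul, h, zero_mul, det_smul, det_one, mul_one] at this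
  exact pow_ne_zero _ (prod_cast_ne_zero q) this.symm

/-- The matrix of multiplication by `v` in the basis of characters. -/
noncomputable def potentialMatrix (v : ((j : Fin d) → ZMod (q j)) → ℂ) :
    Matrix ((j : Fin d) → ZMod (q j)) ((j : Fin d) → ZMod (q j)) ℂ :=
  (∏ j, (q j : ℂ))⁻¹ • ((characterMatrix q)ᴴ * diagonal v * characterMatrix q)

theorem potentialMatrix_zero : potentialMatrix q 0 = 0 := by
  simp [potentialMatrix]

theorem characterMatrix_mul_potentialMatrix (v : ((j : Fin d) → ZMod (q j)) → ℂ) :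
    characterMatrix q * potentialMatrix q v = diagonal v * characterMatrix q := by
  rw [potentialMatrix, mul_smul_comm, ← Matrix.mul_assoc, ← Matrix.mul_assoc,
    characterMatrix_mul_conjTranspose, smul_mul_assoc, smul_mul_assoc, smul_smul,
    inv_mul_cancel₀ (prod_cast_ne_zero q), one_smul, Matrix.one_mul]

theorem potentialMatrix_apply (v : ((j : Fin d) → ZMod (q j)) → ℂ)
    (l l' : (j : Fin d) → ZMod (q j)) :
    potentialMatrix q v l l' =
      (∏ j, (q j : ℂ))⁻¹ *
        ∑ x, star (characterMatrix q x l) * v x * characterMatrix q x l' := by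
  rw [potentialMatrix, Matrix.smul_apply, mul_apply, smul_eq_mul]
  simp only [mul_diagonal, conjTranspose_apply]

theorem potentialMatrix_diag (v : ((j : Fin d) → ZMod (q j)) → ℂ)
    (l : (j : Fin d) → ZMod (q j)) :
    potentialMatrix q v l l = (∏ j, (q j : ℂ))⁻¹ * ∑ x, v x := by
  rw [potentialMatrix_apply]
  congr 1
  refine Finset.sum_congr rfl fun x _ => ?_
  rw [characterMatrix_apply, star_prod, mul_right_comm, ← Finset.prod_mul_distrib,
    Finset.prod_eq_one, one_mul]
  intro j _
  rw [star_stdAddChar, mul_comm, stdAddChar_mul_neg_self]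

theorem potentialMatrix_star (v : ((j : Fin d) → ZMod (q j)) → ℂ) (hv : ∀ x, star (v x) = v x)
    (l l' : (j : Fin d) → ZMod (q j)) :
    potentialMatrix q v l' l = star (potentialMatrix q v l l') := by
  simp only [potentialMatrix_apply, star_mul', star_sum, star_inv₀, star_prod, star_star, hv,
    star_natCast]
  congr 1
  refine Finset.sum_congr rfl fun x _ => ?_
  ring

/-- Row 0 lists all Fourier coefficients of `v` up to a nonzero factor, and the character table is
invertible. -/
theorem eq_zero_of_potentialMatrix_row_zero (v : ((j : Fin d) → ZMod (q j)) → ℂ)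
    (h : ∀ l, potentialMatrix q v 0 l = 0) : v = 0 := by
  refine eq_zero_of_vecMul_eq_zero (characterMatrix_det_ne_zero q) (funext fun l => ?_)
  have := h l
  rw [potentialMatrix_apply] at this
  rcases mul_eq_zero.1 this with h0 | h0
  · exact absurd h0 (inv_ne_zero (prod_cast_ne_zero q))
  · rw [Pi.zero_apply, ← h0]
    simp [vecMul, dotProduct, characterMatrix_apply]

/-- The symbol of the discrete Laplacian. -/
noncomputable def laplacianSymbol (z : Fin d → ℂ) (l : (j : Fin d) → ZMod (q j)) : ℂ :=
  ∑ j, (z j * ZMod.stdAddChar (l j) + (z j)⁻¹ * ZMod.stdAddChar (-l j))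

end CharacterMatrix

/-! ### Diagonalising the Laplacian by plane waves -/

section Floquet

open Matrix

variable {d : ℕ} (q : Fin d → ℕ)

/-- The multiplier `exp (2πi κ / q)` of a unit step in a direction of period `q`. -/
noncomputable def floquetMultiplier (N : ℕ) (κ : ℂ) : ℂ :=
  Complex.exp (2 * (Real.pi : ℂ) * Complex.I * κ / N)

theorem floquetMultiplier_ne_zero (N : ℕ) (κ : ℂ) : floquetMultiplier N κ ≠ 0 :=
  Complex.exp_ne_zero _

/-- The plane wave `n ↦ ∏ⱼ exp (2πi kⱼ nⱼ / qⱼ)`. -/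
noncomputable def planeWave (k : Fin d → ℝ) (n : Fin d → ℤ) : ℂ :=
  ∏ j, floquetMultiplier (q j) (k j) ^ n j

theorem planeWave_ne_zero (k : Fin d → ℝ) (n : Fin d → ℤ) : planeWave q k n ≠ 0 :=
  Finset.prod_ne_zero_iff.2 fun _ _ => zpow_ne_zero _ (floquetMultiplier_ne_zero _ _)

theorem planeWave_add (k : Fin d → ℝ) (n m : Fin d → ℤ) :
    planeWave q k (n + m) = planeWave q k n * planeWave q k m := by
  simp only [planeWave, ← Finset.prod_mul_distrib, Pi.add_apply,
    zpow_add₀ (floquetMultiplier_ne_zero _ _)]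

theorem planeWave_single (k : Fin d → ℝ) (i : Fin d) (m : ℤ) :
    planeWave q k (Pi.single i m) = floquetMultiplier (q i) (k i) ^ m := by
  rw [planeWave, Finset.prod_eq_single i]
  · simp
  · intro j _ hj
    simp [Pi.single_eq_of_ne hj]
  · simp

theorem intCast_add_single (n : Fin d → ℤ) (i : Fin d) (m : ℤ) :
    (fun j => ((n + Pi.single i m : Fin d → ℤ) j : ZMod (q j))) =
      (fun j => (n j : ZMod (q j))) + Pi.single i (m : ZMod (q i)) := by
  funext j
  by_cases h : j = i
  · subst h; simp
  · simp [Pi.single_eq_of_ne h]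

variable [∀ j, NeZero (q j)]

/-- The Floquet phase carries the quotient of `n j` by `q j` and the plane wave on the cell carries
the remainder; together they give the plane wave at `n`. -/
theorem floquetExtension_planeWave (k : Fin d → ℝ) (g : ((j : Fin d) → ZMod (q j)) → ℂ)
    (n : Fin d → ℤ) :
    floquetExtension q k (fun x => planeWave q k (cellRep q x) * g x) n =
      planeWave q k n * g (fun j => (n j : ZMod (q j))) := by
  rw [floquetExtension, ← mul_assoc]
  congr 1
  rw [planeWave, planeWave, Finset.mul_sum, Complex.exp_sum, ← Finset.prod_mul_distrib]
  refine Finset.prod_congr rfl fun j _ => ?_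
  have hq : (q j : ℂ) ≠ 0 := Nat.cast_ne_zero.2 (NeZero.ne (q j))
  have h : Complex.exp (2 * (Real.pi : ℂ) * Complex.I *
      ((k j : ℂ) * ((n j / (q j : ℤ) : ℤ) : ℂ))) =
      floquetMultiplier (q j) (k j) ^ ((q j : ℤ) * (n j / (q j : ℤ))) := by
    rw [floquetMultiplier, ← Complex.exp_int_mul]
    congr 1
    push_cast
    field_simp
  rw [h, cellRep, ZMod.val_intCast, ← zpow_add₀ (floquetMultiplier_ne_zero _ _),
    Int.mul_ediv_add_emod]

theorem floquetExtension_sum (k : Fin d → ℝ) (f : ((j : Fin d) → ZMod (q j)) → ℂ)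
    (n : Fin d → ℤ) :
    ∑ y, floquetExtension q k (Pi.single y 1) n * f y = floquetExtension q k f n := by
  simp [floquetExtension, Pi.single_apply, mul_assoc]

theorem floquetMatrix_mulVec (V : (Fin d → ℤ) → ℂ) (k : Fin d → ℝ)
    (f : ((j : Fin d) → ZMod (q j)) → ℂ) (x : (j : Fin d) → ZMod (q j)) :
    (floquetMatrix q V k *ᵥ f) x =
      discreteSchrodinger V (floquetExtension q k f) (cellRep q x) := by
  simp only [mulVec, dotProduct, floquetMatrix, of_apply, discreteSchrodinger,
    discreteLaplacian, ← floquetExtension_sum q k f, add_mul, Finset.sum_mul,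
    Finset.sum_add_distrib, Finset.mul_sum, mul_assoc]
  rw [Finset.sum_comm, Finset.sum_comm (s := (Finset.univ : Finset (Fin d)))]
  congr 2
  exact Finset.sum_comm

theorem characterMatrix_add_single (x l : (j : Fin d) → ZMod (q j)) (i : Fin d)
    (a : ZMod (q i)) :
    characterMatrix q (x + Pi.single i a) l =
      characterMatrix q x l * ZMod.stdAddChar (a * l i) := by
  simp only [characterMatrix_apply, Pi.add_apply, add_mul, AddChar.map_add_eq_mul,
    Finset.prod_mul_distrib]
  congr 1
  rw [Finset.prod_eq_single i]
  · simp
  · intro j _ hj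
    simp [Pi.single_eq_of_ne hj]
  · simp

theorem intCast_cellRep (x : (j : Fin d) → ZMod (q j)) :
    (fun j => (cellRep q x j : ZMod (q j))) = x := by
  funext j
  simp [cellRep]

/-- A unit step multiplies a plane wave times a character by a scalar, so these functions are
eigenvectors of the Laplacian, while `V` acts through its Fourier matrix. -/
theorem floquetMatrix_mul_planeWave (V : (Fin d → ℤ) → ℂ) (k : Fin d → ℝ) :
    floquetMatrix q V k *
        (diagonal (fun x => planeWave q k (cellRep q x)) * characterMatrix q) =
      diagonal (fun x => planeWave q k (cellRep q x)) * characterMatrix q *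
        (diagonal (laplacianSymbol q fun j => floquetMultiplier (q j) (k j)) +
          potentialMatrix q fun x => V (cellRep q x)) := by
  rw [Matrix.mul_add, Matrix.mul_assoc (diagonal _) _ (potentialMatrix _ _),
    characterMatrix_mul_potentialMatrix]
  ext x l
  have h1 : (floquetMatrix q V k *
        (diagonal (fun x => planeWave q k (cellRep q x)) * characterMatrix q)) x l =
      (floquetMatrix q V k *ᵥ
        fun x => planeWave q k (cellRep q x) * characterMatrix q x l) x := by
    rw [mul_apply]
    simp only [diagonal_mul, mulVec, dotProduct]
  rw [h1, floquetMatrix_mulVec, discreteSchrodinger, discreteLaplacian]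
  have h2 : ∀ n, floquetExtension q k
      (fun x => planeWave q k (cellRep q x) * characterMatrix q x l) n =
      planeWave q k n * characterMatrix q (fun j => (n j : ZMod (q j))) l :=
    fun n => floquetExtension_planeWave q k (fun x => characterMatrix q x l) n
  simp only [sub_eq_add_neg, ← Pi.single_neg, h2, planeWave_add, planeWave_single,
    intCast_add_single, intCast_cellRep, characterMatrix_add_single, Matrix.add_apply, mul_diagonal,
    diagonal_mul, laplacianSymbol, Finset.mul_sum]
  refine congrArg₂ _ (Finset.sum_congr rfl fun j _ => ?_) (by ring)
  simp only [Int.cast_one, Int.cast_neg, one_mul, neg_mul, zpow_one, _root_.zpow_neg_one]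
  ring

theorem floquetDet_eq (V : (Fin d → ℤ) → ℂ) (k : Fin d → ℝ) (l : ℂ) :
    floquetDet q V k l =
      (diagonal (fun m => laplacianSymbol q (fun j => floquetMultiplier (q j) (k j)) m - l) +
          potentialMatrix q fun x => V (cellRep q x)).det := by
  set U := diagonal (fun x => planeWave q k (cellRep q x)) * characterMatrix q with hU
  have hdet : U.det ≠ 0 := by
    rw [hU, det_mul, det_diagonal]
    exact mul_ne_zero (Finset.prod_ne_zero_iff.2 fun _ _ => planeWave_ne_zero _ _ _)
      (characterMatrix_det_ne_zero q)
  have h : (floquetMatrix q V k - l • (1 : Matrix _ _ ℂ)) * U = U *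
      (diagonal (fun m => laplacianSymbol q (fun j => floquetMultiplier (q j) (k j)) m - l) +
          potentialMatrix q fun x => V (cellRep q x)) := by
    have h3 : diagonal
        (fun m => laplacianSymbol q (fun j => floquetMultiplier (q j) (k j)) m - l) =
        diagonal (laplacianSymbol q fun j => floquetMultiplier (q j) (k j)) -
          l • (1 : Matrix _ _ ℂ) := by
      rw [smul_one_eq_diagonal, diagonal_sub]
    rw [h3, sub_add_eq_add_sub, Matrix.sub_mul, Matrix.mul_sub, hU,
      floquetMatrix_mul_planeWave]
    simp
  have h4 := congrArg det h
  rw [det_mul, det_mul U, mul_comm] at h4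
  exact mul_left_cancel₀ hdet h4

end Floquet

/-! ### Trace rigidity and limits of rescaled determinants -/

section DeterminantComparison

open Matrix Filter Topology

theorem tendsto_ofReal_inv_atTop : Tendsto (fun t : ℝ => (t : ℂ)⁻¹) atTop (𝓝 0) := by
  have := (Complex.continuous_ofReal.tendsto 0).comp tendsto_inv_atTop_zero
  simpa [Function.comp_def] using this

variable {n : Type*} [Fintype n] [DecidableEq n]

/-- The hypothesis fixes the characteristic polynomial of `-A`, and that of `A * A` follows from `r²
- A² = (r - A)(r + A)`; traces are sums of roots. -/
theorem trace_eq_and_trace_sq_eq_of_det_add_scalar (A B : Matrix n n ℂ)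
    (h : ∀ s : ℂ, (scalar n s + A).det = (scalar n s + B).det) :
    A.trace = B.trace ∧ (A * A).trace = (B * B).trace := by
  have hneg : (-A).charpoly = (-B).charpoly := by
    refine Polynomial.funext fun s => ?_
    rw [eval_charpoly, eval_charpoly, sub_neg_eq_add, sub_neg_eq_add, h]
  have hpos : ∀ s : ℂ, (scalar n s - A).det = (scalar n s - B).det := by
    intro s
    have e : ∀ M : Matrix n n ℂ, scalar n s - M = -(scalar n (-s) + M) := by
      intro M
      rw [map_neg]; abel
    rw [e, e, det_neg, det_neg, h]
  have hsq : (A * A).charpoly = (B * B).charpoly := by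
    refine Polynomial.funext fun s => ?_
    obtain ⟨r, hr⟩ := IsAlgClosed.exists_pow_nat_eq s (n := 2) (by norm_num)
    have e : ∀ M : Matrix n n ℂ, scalar n s - M * M = (scalar n r - M) * (scalar n r + M) := by
      intro M
      have hc : Commute (scalar n r) M := scalar_commute r (fun _ => Commute.all _ _) M
      rw [← hr, sub_mul, mul_add, mul_add, hc.eq, sq, map_mul]
      abel
    rw [eval_charpoly, eval_charpoly, e, e, det_mul, det_mul, h, hpos]
  constructor
  · have := trace_eq_sum_roots_charpoly (-A)
    rw [hneg, ← trace_eq_sum_roots_charpoly, trace_neg, trace_neg] at this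
    exact neg_injective this
  · rw [trace_eq_sum_roots_charpoly, hsq, ← trace_eq_sum_roots_charpoly]

/-- A Hermitian perturbation of a diagonal matrix which has constant diagonal and does not
change the determinants of the translates vanishes. -/
theorem eq_zero_of_det_add_scalar (c : n → ℂ) (B : Matrix n n ℂ) (b : ℂ)
    (hB : ∀ i j, B j i = star (B i j)) (hb : ∀ i, B i i = b)
    (h : ∀ s : ℂ, (scalar n s + (diagonal c + B)).det = (scalar n s + diagonal c).det) :
    B = 0 := by
  obtain ⟨h1, h2⟩ := trace_eq_and_trace_sq_eq_of_det_add_scalar _ _ h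
  rw [trace_add, add_eq_left] at h1
  ext i₀ j₀
  have hb0 : b = 0 := by
    have : (Fintype.card n : ℂ) * b = 0 := by
      rw [← h1]; simp [trace, hb]
    rcases mul_eq_zero.1 this with h0 | h0
    · exact absurd (Nat.cast_eq_zero.1 h0) (Fintype.card_pos_iff.2 ⟨i₀⟩).ne'
    · exact h0
  -- As the diagonal of `B` is now zero, the cross terms in the trace of `(diagonal c + B)²` vanish.
  -- This leaves the trace of `B * B`, which for Hermitian `B` is the sum of the `|B i j|²`.
  have hcB : (diagonal c * B).trace = 0 := by simp [trace, diagonal_mul, hb, hb0]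
  rw [add_mul, mul_add, mul_add, trace_add, trace_add, trace_add, trace_mul_comm B, hcB] at h2
  have h3 : (B * B).trace = 0 := by linear_combination h2
  have h4 : ∑ i, ∑ j, Complex.normSq (B i j) = 0 := by
    have : ((∑ i, ∑ j, Complex.normSq (B i j) : ℝ) : ℂ) = 0 := by
      rw [← h3]
      push_cast
      simp only [trace, diag_apply, mul_apply]
      refine Finset.sum_congr rfl fun i _ => Finset.sum_congr rfl fun j _ => ?_
      rw [hB i j, ← Complex.mul_conj]
      rfl
    exact_mod_cast this
  have h5 := (Finset.sum_eq_zero_iff_of_nonneg fun i _ =>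
    Finset.sum_nonneg fun j _ => Complex.normSq_nonneg (B i j)).1 h4 i₀ (Finset.mem_univ _)
  have h6 := (Finset.sum_eq_zero_iff_of_nonneg fun j _ =>
    Complex.normSq_nonneg (B i₀ j)).1 h5 j₀ (Finset.mem_univ _)
  exact Complex.normSq_eq_zero.1 h6

/-- If the diagonal entries outside `p` grow linearly, then the rescaled determinant converges
to a multiple of the minor on `p`. -/
theorem tendsto_rescaled_det (p : n → Prop) [DecidablePred p] (δ : ℝ → n → ℂ) (c : n → ℂ)
    (B : Matrix n n ℂ) (hp : ∀ i, p i → Tendsto (fun t => δ t i) atTop (𝓝 (c i)))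
    (hnp : ∀ i, ¬p i → Tendsto (fun t : ℝ => (t : ℂ)⁻¹ * δ t i) atTop (𝓝 (c i))) :
    Tendsto (fun t : ℝ => (∏ i, if p i then (1 : ℂ) else (t : ℂ)⁻¹) *
        (diagonal (δ t) + B).det) atTop
      (𝓝 ((diagonal (fun i : {i // p i} => c i) + toSquareBlockProp B p).det *
        ∏ i : {i // ¬p i}, c i)) := by
  set r : ℝ → n → ℂ := fun t i => if p i then 1 else (t : ℂ)⁻¹ with hr
  -- Dividing the rows outside `p` by `t` removes their `B` entries in the limit, so the limit is
  -- block triangular.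
  set N : Matrix n n ℂ := of fun i j => diagonal c i j + if p i then B i j else 0 with hN
  have hlim : Tendsto (fun t : ℝ => diagonal (r t) * (diagonal (δ t) + B)) atTop (𝓝 N) := by
    refine tendsto_pi_nhds.2 fun i => tendsto_pi_nhds.2 fun j => ?_
    simp only [diagonal_mul, Matrix.add_apply, mul_add, hN, of_apply, hr]
    by_cases hpi : p i
    · simp only [hpi, if_true, one_mul]
      refine Tendsto.add ?_ tendsto_const_nhds
      by_cases hij : i = j
      · subst hij; simpa using hp i hpi
      · simp [hij]
    · simp only [hpi, if_false]
      refine Tendsto.add ?_ (by simpa using tendsto_ofReal_inv_atTop.mul_const (B i j))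
      by_cases hij : i = j
      · subst hij; simpa using hnp i hpi
      · simp [hij]
  have hdet := (continuous_id.matrix_det.tendsto N).comp hlim
  simp only [Function.comp_def, id, det_mul, det_diagonal] at hdet
  convert hdet using 2
  rw [twoBlockTriangular_det N p]
  · congr 1
    · congr 1
      ext i j
      simp [hN, toSquareBlockProp_def, i.2, diagonal_apply, Subtype.ext_iff]
    · rw [← det_diagonal]
      congr 1
      ext i j
      simp [hN, toSquareBlockProp_def, i.2, diagonal_apply, Subtype.ext_iff]
  · intro i hi j hj
    have : i ≠ j := fun h => hi (h ▸ hj)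
    simp [hN, hi, this]

end DeterminantComparison

/-! ### Extension from real to complex quasimomenta -/

section RealPoints

/-- An entire function of several variables that vanishes at the real points vanishes. -/
theorem eq_zero_of_differentiable_of_real {ι : Type*} [Fintype ι]
    (f : (ι → ℂ) → ℂ) (hf : Differentiable ℂ f)
    (h : ∀ k : ι → ℝ, f (fun j => (k j : ℂ)) = 0) (κ : ι → ℂ) : f κ = 0 := by
  classical
  -- `T` is the set of coordinates allowed to be complex; each induction step frees one more by the
  -- identity theorem in one variable.
  suffices H : ∀ T : Finset ι, ∀ κ : ι → ℂ, (∀ j, j ∉ T → ((κ j).re : ℂ) = κ j) → f κ = 0 from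
    H Finset.univ κ (by simp)
  intro T
  induction T using Finset.induction_on with
  | empty =>
    intro κ hκ
    rw [← h fun j => (κ j).re]
    congr 1
    funext j
    exact (hκ j (by simp)).symm
  | insert i T hi ih =>
    intro κ hκ
    have hg : Differentiable ℂ fun w : ℂ => f (Function.update κ i w) :=
      hf.comp fun w => (hasFDerivAt_update κ w).differentiableAt
    have hreal : ∀ x : ℝ, f (Function.update κ i (x : ℂ)) = 0 := by
      intro x
      refine ih _ fun j hj => ?_
      by_cases hji : j = i
      · subst hji; simp
      · rw [Function.update_of_ne hji]
        exact hκ j (by simp [hji, hj])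
    have hz : (fun w : ℂ => f (Function.update κ i w)) = fun _ => 0 := by
      refine AnalyticOnNhd.eq_of_frequently_eq (z₀ := 0)
        (fun w _ => hg.analyticAt w) (fun w _ => analyticAt_const) ?_
      have ht : Filter.Tendsto (fun m : ℕ => (((1 : ℝ) / (m + 1) : ℝ) : ℂ)) Filter.atTop
          (nhdsWithin 0 {0}ᶜ) := by
        refine tendsto_nhdsWithin_iff.2 ⟨?_, Filter.Eventually.of_forall fun m => ?_⟩
        · have := (Complex.continuous_ofReal.tendsto 0).comp
            (tendsto_one_div_add_atTop_nhds_zero_nat (𝕜 := ℝ))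
          simpa [Function.comp_def] using this
        · simp only [Set.mem_compl_iff, Set.mem_singleton_iff, Complex.ofReal_eq_zero]
          positivity
      exact ht.frequently (Filter.Frequently.of_forall fun m => hreal _)
    have := congrFun hz (κ i)
    simpa using this

end RealPoints

/-! ### Determinants along lines at infinity -/

section Asymptotics

open Matrix Filter Topology

variable {d : ℕ} (q : Fin d → ℕ) [∀ j, NeZero (q j)]

theorem exists_floquetMultiplier_eq (N : ℕ) [NeZero N] {z : ℂ} (hz : z ≠ 0) :
    ∃ κ, floquetMultiplier N κ = z := by
  have hN : (N : ℂ) ≠ 0 := Nat.cast_ne_zero.2 (NeZero.ne N)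
  refine ⟨N * Complex.log z / (2 * (Real.pi : ℂ) * Complex.I), ?_⟩
  rw [floquetMultiplier]
  have := Complex.two_pi_I_ne_zero
  rw [mul_div_cancel₀ _ this, mul_div_cancel_left₀ _ hN, Complex.exp_log hz]

/-- The determinant of the Floquet operator in the basis of characters. -/
noncomputable def symbolDet (v : ((j : Fin d) → ZMod (q j)) → ℂ) (a : ℂ) (z : Fin d → ℂ) : ℂ :=
  (diagonal (fun l => laplacianSymbol q z l - a) + potentialMatrix q v).det

/-- The multipliers are exponentials, so their inverses are entire too. The maps `φ` make it
possible to freeze the coordinates outside `S`. -/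
theorem differentiable_symbolDet (v : ((j : Fin d) → ZMod (q j)) → ℂ) (a : ℂ)
    (φ : Fin d → (Fin d → ℂ) → ℂ) (hφ : ∀ j, Differentiable ℂ (φ j)) :
    Differentiable ℂ fun κ => symbolDet q v a fun j => floquetMultiplier (q j) (φ j κ) := by
  have hentry : ∀ l m, Differentiable ℂ fun κ =>
      (diagonal (fun l => laplacianSymbol q (fun j => floquetMultiplier (q j) (φ j κ)) l - a) +
        potentialMatrix q v) l m := by
    intro l m
    simp only [Matrix.add_apply]
    apply Differentiable.add_const
    by_cases hlm : l = m
    · subst hlm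
      simp only [diagonal_apply_eq, laplacianSymbol, floquetMultiplier, ← Complex.exp_neg]
      apply Differentiable.sub_const
      apply Differentiable.fun_sum
      intro j _
      have := hφ j
      fun_prop
    · simp [diagonal_apply_ne _ hlm]
  simp only [symbolDet, det_apply]
  apply Differentiable.fun_sum
  intro σ _
  apply Differentiable.const_smul
  generalize (Finset.univ : Finset ((j : Fin d) → ZMod (q j))) = T
  induction T using Finset.induction_on with
  | empty => simp
  | insert i T hi ih =>
    simp only [Finset.prod_insert hi]
    exact (hentry (σ i) i).mul ih

/-- Equality of the determinants at real quasimomenta extends to complex multipliers. -/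
theorem symbolDet_eq_of_real (v w : ((j : Fin d) → ZMod (q j)) → ℂ) (a : ℂ) (S : Finset (Fin d))
    (kstar : Fin d → ℝ)
    (h : ∀ k : Fin d → ℝ, (∀ j, j ∉ S → k j = kstar j) →
      symbolDet q v a (fun j => floquetMultiplier (q j) (k j)) =
        symbolDet q w a fun j => floquetMultiplier (q j) (k j))
    (z : Fin d → ℂ) (hz : ∀ j, z j ≠ 0)
    (hzS : ∀ j, j ∉ S → z j = floquetMultiplier (q j) (kstar j)) :
    symbolDet q v a z = symbolDet q w a z := by
  choose κ hκ using fun j => exists_floquetMultiplier_eq (q j) (hz j)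
  set φ : Fin d → (Fin d → ℂ) → ℂ := fun j x => if j ∈ S then x j else kstar j with hφ
  have hdiff : ∀ j, Differentiable ℂ (φ j) := by
    intro j
    by_cases hj : j ∈ S
    · simp only [hφ, hj, if_true]; fun_prop
    · simp only [hφ, hj, if_false]; fun_prop
  have key := eq_zero_of_differentiable_of_real _
    ((differentiable_symbolDet q v a φ hdiff).sub (differentiable_symbolDet q w a φ hdiff))
    (fun k => by
      have := h (fun j => if j ∈ S then k j else kstar j) (fun j hj => by simp [hj])
      simp only [Pi.sub_apply, hφ, sub_eq_zero]
      simpa only [apply_ite Complex.ofReal] using this) κ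
  have hzφ : (fun j => floquetMultiplier (q j) (φ j κ)) = z := by
    funext j
    by_cases hj : j ∈ S
    · simp [hφ, hj, hκ]
    · simp [hφ, hj, hzS j hj]
  simp only [Pi.sub_apply, hzφ, sub_eq_zero] at key
  exact key

theorem tendsto_inv_mul_affine (α w : ℂ) :
    Tendsto (fun t : ℝ => (t : ℂ)⁻¹ * (t * α + w)) atTop (𝓝 α) := by
  have : Tendsto (fun t : ℝ => α + (t : ℂ)⁻¹ * w) atTop (𝓝 α) := by
    simpa using (tendsto_ofReal_inv_atTop.mul_const w).const_add α
  refine this.congr' ?_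
  filter_upwards [eventually_ne_atTop (0 : ℝ)] with t ht
  have : (t : ℂ) ≠ 0 := Complex.ofReal_ne_zero.2 ht
  field_simp

theorem tendsto_affine_inv {α w : ℂ} :
    Tendsto (fun t : ℝ => (t * α + w)⁻¹) atTop (𝓝 (if α = 0 then w⁻¹ else 0)) := by
  by_cases hα : α = 0
  · simp [hα]
  · have := tendsto_ofReal_inv_atTop.mul ((tendsto_inv_mul_affine α w).inv₀ hα)
    simp only [zero_mul] at this
    rw [if_neg hα]
    refine this.congr' ?_
    filter_upwards [eventually_ne_atTop (0 : ℝ)] with t ht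
    have : (t : ℂ) ≠ 0 := Complex.ofReal_ne_zero.2 ht
    rw [mul_inv, inv_inv, inv_mul_cancel_left₀ this]

theorem eventually_affine_ne_zero {α w : ℂ} (h : α = 0 → w ≠ 0) :
    ∀ᶠ t : ℝ in atTop, t * α + w ≠ 0 := by
  by_cases hα : α = 0
  · simp [hα, h hα]
  · filter_upwards [(tendsto_inv_mul_affine α w).eventually_ne hα] with t ht h0
    exact ht (by rw [h0, mul_zero])

/-- The determinant along a line at infinity, on which the symbols in `p` stay bounded. -/
theorem tendsto_rescaled_symbolDet (w : ((j : Fin d) → ZMod (q j)) → ℂ) (a s : ℂ)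
    (α β γ : Fin d → ℂ) (hβ : ∀ j, α j = 0 → β j = 0) (p : ((j : Fin d) → ZMod (q j)) → Prop)
    [DecidablePred p] (hp : ∀ l, p l → ∑ j, α j * (ZMod.stdAddChar (l j) : ℂ) = 0)
    (hpβ : ∀ l, p l → ∑ j, β j * (ZMod.stdAddChar (l j) : ℂ) = 1) :
    Tendsto (fun t : ℝ => (∏ l, if p l then (1 : ℂ) else (t : ℂ)⁻¹) *
        symbolDet q w a fun j => t * α j + (s * β j + γ j)) atTop
      (𝓝 ((scalar {l // p l} s + (diagonal (fun l : {l // p l} =>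
          ∑ j, γ j * (ZMod.stdAddChar (l.1 j) : ℂ) +
            ∑ j, (if α j = 0 then (γ j)⁻¹ else 0) * (ZMod.stdAddChar (-l.1 j) : ℂ) - a) +
          toSquareBlockProp (potentialMatrix q w) p)).det *
        ∏ l : {l // ¬p l}, ∑ j, α j * (ZMod.stdAddChar (l.1 j) : ℂ))) := by
  have hsplit : ∀ (t : ℝ) (l : (j : Fin d) → ZMod (q j)),
      laplacianSymbol q (fun j => t * α j + (s * β j + γ j)) l =
        t * ∑ j, α j * (ZMod.stdAddChar (l j) : ℂ) + s * ∑ j, β j * (ZMod.stdAddChar (l j) : ℂ) +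
          ∑ j, γ j * (ZMod.stdAddChar (l j) : ℂ) +
          ∑ j, (t * α j + (s * β j + γ j))⁻¹ * (ZMod.stdAddChar (-l j) : ℂ) := by
    intro t l
    simp only [laplacianSymbol, Finset.mul_sum, ← Finset.sum_add_distrib]
    refine Finset.sum_congr rfl fun j _ => ?_
    ring
  have hinv : ∀ l : (j : Fin d) → ZMod (q j), Tendsto (fun t : ℝ =>
      ∑ j, (t * α j + (s * β j + γ j))⁻¹ * (ZMod.stdAddChar (-l j) : ℂ)) atTop
        (𝓝 (∑ j, (if α j = 0 then (γ j)⁻¹ else 0) * (ZMod.stdAddChar (-l j) : ℂ))) := by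
    intro l
    refine tendsto_finsetSum _ fun j _ => Tendsto.mul_const _ ?_
    -- Only the directions with `α j = 0` keep an inverse term in the limit. There `β j = 0`, so
    -- this term does not depend on `s`.
    have h0 := tendsto_affine_inv (α := α j) (w := s * β j + γ j)
    by_cases hj : α j = 0
    · simp [hj, hβ j hj]
    · simpa [hj] using h0
  set c : ((j : Fin d) → ZMod (q j)) → ℂ := fun l => if p l then
      s + (∑ j, γ j * (ZMod.stdAddChar (l j) : ℂ) +
        ∑ j, (if α j = 0 then (γ j)⁻¹ else 0) * (ZMod.stdAddChar (-l j) : ℂ) - a)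
    else ∑ j, α j * (ZMod.stdAddChar (l j) : ℂ) with hc
  have hc1 : ∀ l, p l → c l = s + (∑ j, γ j * (ZMod.stdAddChar (l j) : ℂ) +
        ∑ j, (if α j = 0 then (γ j)⁻¹ else 0) * (ZMod.stdAddChar (-l j) : ℂ) - a) :=
    fun l hl => if_pos hl
  have hc2 : ∀ l, ¬p l → c l = ∑ j, α j * (ZMod.stdAddChar (l j) : ℂ) := fun l hl => if_neg hl
  clear_value c
  have key := tendsto_rescaled_det p
    (fun t l => laplacianSymbol q (fun j => t * α j + (s * β j + γ j)) l - a) c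
    (potentialMatrix q w) (fun l hl => ?_) (fun l hl => ?_)
  · have e1 : diagonal (fun l : {l // p l} => c l) = scalar {l // p l} s +
        diagonal (fun l : {l // p l} => ∑ j, γ j * (ZMod.stdAddChar (l.1 j) : ℂ) +
            ∑ j, (if α j = 0 then (γ j)⁻¹ else 0) * (ZMod.stdAddChar (-l.1 j) : ℂ) - a) := by
      rw [scalar_apply, diagonal_add]
      exact congrArg diagonal (funext fun l => hc1 l.1 l.2)
    have e2 : ∏ l : {l // ¬p l}, c l =
        ∏ l : {l // ¬p l}, ∑ j, α j * (ZMod.stdAddChar (l.1 j) : ℂ) :=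
      Finset.prod_congr rfl fun l _ => hc2 l.1 l.2
    rw [e1, e2, add_assoc] at key
    exact key
  · simp only [hsplit, hp l hl, hpβ l hl, hc1 l hl, mul_zero, zero_add, mul_one]
    have := ((hinv l).const_add (s + ∑ j, γ j * (ZMod.stdAddChar (l j) : ℂ))).sub_const a
    convert this using 2
    ring
  · rw [hc2 l hl]
    have h1 := tendsto_inv_mul_affine (∑ j, α j * (ZMod.stdAddChar (l j) : ℂ))
      (s * ∑ j, β j * (ZMod.stdAddChar (l j) : ℂ) + ∑ j, γ j * (ZMod.stdAddChar (l j) : ℂ) - a)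
    have h2 := h1.add (tendsto_ofReal_inv_atTop.mul (hinv l))
    rw [zero_mul, add_zero] at h2
    refine h2.congr fun t => ?_
    rw [hsplit]; ring

/-- If the determinants for `v` and `0` agree for all multipliers that are prescribed outside
`S`, then the blocks of `v` which stay bounded along a line at infinity vanish. -/
theorem potentialMatrix_apply_eq_zero_of_direction (v : ((j : Fin d) → ZMod (q j)) → ℂ)
    (hv : ∀ x, star (v x) = v x) (a : ℂ) (S : Finset (Fin d)) (γ : Fin d → ℂ) (hγ : ∀ j, γ j ≠ 0)
    (h : ∀ z : Fin d → ℂ, (∀ j, z j ≠ 0) → (∀ j, j ∉ S → z j = γ j) →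
      symbolDet q v a z = symbolDet q 0 a z)
    (α β : Fin d → ℂ) (hα : ∀ j, j ∉ S → α j = 0) (hβ : ∀ j, α j = 0 → β j = 0)
    (hαβ : ∀ l : (j : Fin d) → ZMod (q j), ∑ j, α j * (ZMod.stdAddChar (l j) : ℂ) = 0 →
      ∑ j, β j * (ZMod.stdAddChar (l j) : ℂ) = 1)
    (l m : (j : Fin d) → ZMod (q j)) (hl : ∑ j, α j * (ZMod.stdAddChar (l j) : ℂ) = 0)
    (hm : ∑ j, α j * (ZMod.stdAddChar (m j) : ℂ) = 0) :
    potentialMatrix q v l m = 0 := by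
  classical
  obtain ⟨p, hp⟩ : ∃ p : ((j : Fin d) → ZMod (q j)) → Prop,
      ∀ l, p l ↔ ∑ j, α j * (ZMod.stdAddChar (l j) : ℂ) = 0 := ⟨_, fun _ => Iff.rfl⟩
  have hlim := fun s w => tendsto_rescaled_symbolDet q w a s α β γ hβ p (fun l => (hp l).1)
    (fun l hl => hαβ l ((hp l).1 hl))
  have hprod : ∏ l : {l // ¬p l}, ∑ j, α j * (ZMod.stdAddChar (l.1 j) : ℂ) ≠ 0 :=
    Finset.prod_ne_zero_iff.2 fun l _ => fun h0 => l.2 ((hp l.1).2 h0)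
  have hdet : ∀ s : ℂ, (scalar {l // p l} s + (diagonal (fun l : {l // p l} =>
      ∑ j, γ j * (ZMod.stdAddChar (l.1 j) : ℂ) +
        ∑ j, (if α j = 0 then (γ j)⁻¹ else 0) * (ZMod.stdAddChar (-l.1 j) : ℂ) - a) +
      toSquareBlockProp (potentialMatrix q v) p)).det =
      (scalar {l // p l} s + diagonal (fun l : {l // p l} =>
      ∑ j, γ j * (ZMod.stdAddChar (l.1 j) : ℂ) +
        ∑ j, (if α j = 0 then (γ j)⁻¹ else 0) * (ZMod.stdAddChar (-l.1 j) : ℂ) - a)).det := by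
    intro s
    have h2 := hlim s 0
    have h3 : toSquareBlockProp (potentialMatrix q 0) p = 0 := by
      rw [potentialMatrix_zero]; rfl
    rw [h3, add_zero] at h2
    refine mul_right_cancel₀ hprod (tendsto_nhds_unique ((hlim s v).congr' ?_) h2)
    -- For large `t` the line consists of admissible multipliers, so `h` identifies the two
    -- determinants before the limit.
    have hev : ∀ᶠ t : ℝ in atTop, ∀ j, t * α j + (s * β j + γ j) ≠ 0 :=
      eventually_all.2 fun j => eventually_affine_ne_zero fun hj => by simp [hβ j hj, hγ j]
    filter_upwards [hev] with t ht
    rw [h _ ht fun j hj => by simp [hα j hj, hβ j (hα j hj)]]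
  have := eq_zero_of_det_add_scalar _ (toSquareBlockProp (potentialMatrix q v) p) ((∏ j, (q j : ℂ))⁻¹ * ∑ x, v x)
    (fun i j => potentialMatrix_star q v hv i.1 j.1) (fun i => potentialMatrix_diag q v i.1) hdet
  exact congrFun (congrFun this ⟨l, (hp l).2 hl⟩) ⟨m, (hp m).2 hm⟩

end Asymptotics

/-! ### Roots of unity and similar triangles in the unit circle -/

section RootsOfUnity

theorem eq_one_of_pow_eq_one_of_coprime {M : Type*} [Monoid M] {x : M} {m n : ℕ}
    (h : m.Coprime n) (hm : x ^ m = 1) (hn : x ^ n = 1) : x = 1 := by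
  simpa [h] using pow_gcd_eq_one.2 ⟨hm, hn⟩

theorem stdAddChar_pow_self {N : ℕ} [NeZero N] (a : ZMod N) :
    (ZMod.stdAddChar a : ℂ) ^ N = 1 := by
  rw [← AddChar.map_nsmul_eq_pow]
  simp

theorem stdAddChar_eq_one_iff {N : ℕ} [NeZero N] {a : ZMod N} :
    (ZMod.stdAddChar a : ℂ) = 1 ↔ a = 0 := by
  rw [← AddChar.map_zero_eq_one (ZMod.stdAddChar (N := N))]
  exact ZMod.injective_stdAddChar.eq_iff

/-- A quadratic polynomial with three distinct roots vanishes. -/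
theorem quadratic_coeff_eq_zero {K : Type*} [Field K] {a b c x y z : K} (hxy : x ≠ y)
    (hyz : y ≠ z) (hzx : z ≠ x) (hx : a * x ^ 2 + b * x + c = 0)
    (hy : a * y ^ 2 + b * y + c = 0) (hz : a * z ^ 2 + b * z + c = 0) :
    a = 0 ∧ b = 0 ∧ c = 0 := by
  have h1 : a * (x + y) + b = 0 :=
    mul_left_cancel₀ (sub_ne_zero.2 hxy) (by linear_combination hx - hy)
  have h2 : a * (y + z) + b = 0 :=
    mul_left_cancel₀ (sub_ne_zero.2 hyz) (by linear_combination hy - hz)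
  have ha : a = 0 := mul_left_cancel₀ (sub_ne_zero.2 hzx) (by linear_combination h2 - h1)
  have hb : b = 0 := by simpa [ha] using h1
  exact ⟨ha, hb, by simpa [ha, hb] using hx⟩

/-- Three pairs `(x, u)`, `(y, v)`, `(z, w)` with vanishing determinant lie on a line. -/
theorem exists_affine_of_collinear {K : Type*} [Field K] {x y z u v w : K} (hxy : x ≠ y)
    (h : (y - z) * u + (z - x) * v + (x - y) * w = 0) :
    ∃ a b, u = a * x + b ∧ v = a * y + b ∧ w = a * z + b := by
  have hxy' : x - y ≠ 0 := sub_ne_zero.2 hxy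
  refine ⟨(u - v) / (x - y), u - (u - v) / (x - y) * x, by ring, ?_, ?_⟩
  · field_simp
    ring
  · refine mul_left_cancel₀ hxy' ?_
    field_simp
    linear_combination h

/-- Numbers `ρᵢ` and `σᵢ` (`i = 1, 2, 3`) of modulus one such that the triangles `ρ`, `σ` are
directly similar, possibly with `σ` degenerate: then either `σ` is constant or `σ` is a multiple
of `ρ`. -/
theorem const_or_proportional_of_collinear {ρ₁ ρ₂ ρ₃ σ₁ σ₂ σ₃ : ℂ}
    (h₁₂ : ρ₁ ≠ ρ₂) (h₂₃ : ρ₂ ≠ ρ₃) (h₃₁ : ρ₃ ≠ ρ₁)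
    (hρ₁ : ρ₁ * star ρ₁ = 1) (hρ₂ : ρ₂ * star ρ₂ = 1) (hρ₃ : ρ₃ * star ρ₃ = 1)
    (hσ₁ : σ₁ * star σ₁ = 1) (hσ₂ : σ₂ * star σ₂ = 1) (hσ₃ : σ₃ * star σ₃ = 1)
    (h : (ρ₂ - ρ₃) * σ₁ + (ρ₃ - ρ₁) * σ₂ + (ρ₁ - ρ₂) * σ₃ = 0) :
    (σ₁ = σ₂ ∧ σ₂ = σ₃) ∨ ∃ a, σ₁ = a * ρ₁ ∧ σ₂ = a * ρ₂ ∧ σ₃ = a * ρ₃ := by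
  obtain ⟨a, b, h1, h2, h3⟩ := exists_affine_of_collinear h₁₂ h
  have hs := congrArg star h
  simp only [star_add, star_sub, star_mul', star_zero] at hs
  -- This is the conjugate relation times `-ρ₁ρ₂ρ₃`, since `star ρᵢ` is the inverse of `ρᵢ`. Hence
  -- `ρᵢ * star σᵢ` is also an affine function of `ρᵢ`.
  have h' : (ρ₂ - ρ₃) * (ρ₁ * star σ₁) + (ρ₃ - ρ₁) * (ρ₂ * star σ₂) +
      (ρ₁ - ρ₂) * (ρ₃ * star σ₃) = 0 := by
    linear_combination (-ρ₁ * ρ₂ * ρ₃) * hs + ρ₁ * ρ₃ * star σ₁ * hρ₂ - ρ₁ * ρ₂ * star σ₁ * hρ₃ + ρ₁ * ρ₂ * star σ₂ * hρ₃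
      - ρ₂ * ρ₃ * star σ₂ * hρ₁ + ρ₂ * ρ₃ * star σ₃ * hρ₁ - ρ₁ * ρ₃ * star σ₃ * hρ₂
  obtain ⟨e, f, h4, h5, h6⟩ := exists_affine_of_collinear h₁₂ h'
  -- Multiplying the two affine expressions gives `(aρ + b)(eρ + f) = ρ`, a quadratic with the three
  -- distinct roots `ρᵢ`, so its coefficients vanish.
  have key : ∀ ρ σ : ℂ, σ * star σ = 1 → σ = a * ρ + b → ρ * star σ = e * ρ + f →
      (a * e) * ρ ^ 2 + (a * f + b * e - 1) * ρ + b * f = 0 := by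
    intro ρ σ hσ h7 h8
    linear_combination ρ * hσ - (e * ρ + f) * h7 - σ * h8
  obtain ⟨hae, hm, hbf⟩ := quadratic_coeff_eq_zero h₁₂ h₂₃ h₃₁ (key _ _ hσ₁ h1 h4)
    (key _ _ hσ₂ h2 h5) (key _ _ hσ₃ h3 h6)
  rcases mul_eq_zero.1 hae with ha | he
  · left
    simp [h1, h2, h3, ha]
  · right
    rw [he, mul_zero, add_zero] at hm
    have hf : f ≠ 0 := by rintro rfl; simp at hm
    have hb : b = 0 := (mul_eq_zero.1 hbf).resolve_right hf
    exact ⟨a, by rw [h1, hb, add_zero], by rw [h2, hb, add_zero], by rw [h3, hb, add_zero]⟩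

theorem stdAddChar_mul_star_self {N : ℕ} [NeZero N] (a : ZMod N) :
    (ZMod.stdAddChar a : ℂ) * star (ZMod.stdAddChar a) = 1 := by
  rw [star_stdAddChar, stdAddChar_mul_neg_self]

/-- The only common root of unity of two coprime orders is 1. -/
theorem stdAddChar_ne_of_coprime {M N : ℕ} [NeZero M] [NeZero N] (h : M.Coprime N) {a : ZMod M}
    {b : ZMod N} (hab : a ≠ 0 ∨ b ≠ 0) :
    (ZMod.stdAddChar a : ℂ) ≠ ZMod.stdAddChar b := by
  intro heq
  have h1 := eq_one_of_pow_eq_one_of_coprime h (stdAddChar_pow_self a)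
    (by rw [heq]; exact stdAddChar_pow_self b)
  have ha := stdAddChar_eq_one_iff.1 h1
  have hb := stdAddChar_eq_one_iff.1 (heq ▸ h1)
  exact hab.elim (fun h => h ha) fun h => h hb

/-- By the triangle dichotomy, the values at `b` are either constant or a multiple of those at `a`.
The constant, respectively the factor, is a root of unity of two coprime orders, hence 1. Thus the
bounded block looks like 0 or `l` in the two directions where `β` will live. -/
theorem eq_zero_or_eq_of_collinear {N₁ N₂ N₃ : ℕ} [NeZero N₁] [NeZero N₂] [NeZero N₃]
    (c₁₂ : N₁.Coprime N₂) (c₂₃ : N₂.Coprime N₃) (c₃₁ : N₃.Coprime N₁)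
    {a₁ b₁ : ZMod N₁} {a₂ b₂ : ZMod N₂} {a₃ b₃ : ZMod N₃}
    (h₁₂ : a₁ ≠ 0 ∨ a₂ ≠ 0) (h₂₃ : a₂ ≠ 0 ∨ a₃ ≠ 0) (h₃₁ : a₃ ≠ 0 ∨ a₁ ≠ 0)
    (h : (ZMod.stdAddChar a₂ - ZMod.stdAddChar a₃) * (ZMod.stdAddChar b₁ : ℂ) +
      (ZMod.stdAddChar a₃ - ZMod.stdAddChar a₁) * ZMod.stdAddChar b₂ +
      (ZMod.stdAddChar a₁ - ZMod.stdAddChar a₂) * ZMod.stdAddChar b₃ = 0) :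
    (b₁ = 0 ∧ b₂ = 0) ∨ (b₁ = a₁ ∧ b₂ = a₂) := by
  rcases const_or_proportional_of_collinear (stdAddChar_ne_of_coprime c₁₂ h₁₂)
    (stdAddChar_ne_of_coprime c₂₃ h₂₃) (stdAddChar_ne_of_coprime c₃₁ h₃₁)
    (stdAddChar_mul_star_self _) (stdAddChar_mul_star_self _) (stdAddChar_mul_star_self _)
    (stdAddChar_mul_star_self _) (stdAddChar_mul_star_self _) (stdAddChar_mul_star_self _) h
    with ⟨h1, -⟩ | ⟨a, h1, h2, -⟩
  · left
    by_contra hb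
    exact stdAddChar_ne_of_coprime c₁₂ (by tauto) h1
  · right
    have hs : ∀ {N : ℕ} [NeZero N] {x y : ZMod N},
        (ZMod.stdAddChar x : ℂ) = a * ZMod.stdAddChar y → a = ZMod.stdAddChar (x - y) := by
      intro N _ x y hxy
      rw [sub_eq_add_neg, AddChar.map_add_eq_mul, hxy, mul_assoc, stdAddChar_mul_neg_self, mul_one]
    have h3 : (ZMod.stdAddChar (b₁ - a₁) : ℂ) = ZMod.stdAddChar (b₂ - a₂) :=
      (hs h1).symm.trans (hs h2)
    by_contra hb
    refine stdAddChar_ne_of_coprime c₁₂ ?_ h3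
    rw [sub_ne_zero, sub_ne_zero]
    tauto

end RootsOfUnity

/-! ### Choice of directions and vanishing of all Fourier coefficients -/

section Rigidity

theorem sum_single_mul {ι R : Type*} [Fintype ι] [DecidableEq ι] [NonUnitalNonAssocSemiring R]
    (i : ι) (a : R) (g : ι → R) : ∑ j, (Pi.single i a : ι → R) j * g j = a * g i := by
  simp [Pi.single_apply]

variable {d : ℕ} (q : Fin d → ℕ) [∀ j, NeZero (q j)]

theorem potentialMatrix_zero_apply_eq_zero (hq : ∀ i j : Fin d, i ≠ j → Nat.Coprime (q i) (q j))
    (v : ((j : Fin d) → ZMod (q j)) → ℂ) (hv : ∀ x, star (v x) = v x) (a : ℂ)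
    (S : Finset (Fin d)) (hS : 3 ≤ S.card) (γ : Fin d → ℂ) (hγ : ∀ j, γ j ≠ 0)
    (h : ∀ z : Fin d → ℂ, (∀ j, z j ≠ 0) → (∀ j, j ∉ S → z j = γ j) →
      symbolDet q v a z = symbolDet q 0 a z) (l : (j : Fin d) → ZMod (q j)) :
    potentialMatrix q v 0 l = 0 := by
  by_cases hl : ∃ s ∈ S, ∃ t ∈ S, s ≠ t ∧ l s = 0 ∧ l t = 0
  · obtain ⟨s, hs, t, ht, hst, hls, hlt⟩ := hl
    have hα : ∀ g : Fin d → ℂ,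
        ∑ j, (Pi.single s 1 + Pi.single t (-1) : Fin d → ℂ) j * g j = g s - g t := by
      intro g
      simp only [Pi.add_apply, add_mul, Finset.sum_add_distrib, sum_single_mul]
      ring
    -- With `α = e_s - e_t`, a bounded index `m` has equal characters at `s` and `t`. Coprimality
    -- makes both equal to 1, so `β = e_s` works.
    refine potentialMatrix_apply_eq_zero_of_direction q v hv a S γ hγ h
      (Pi.single s 1 + Pi.single t (-1)) (Pi.single s 1) ?_ ?_ ?_ 0 l ?_ ?_
    · intro j hj
      have h1 : j ≠ s := fun e => hj (e ▸ hs)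
      have h2 : j ≠ t := fun e => hj (e ▸ ht)
      simp [h1, h2]
    · intro j hj
      by_cases h1 : j = s
      · subst h1
        simp [hst] at hj
      · simp [h1]
    · intro m hm
      rw [hα, sub_eq_zero] at hm
      rw [sum_single_mul, one_mul, stdAddChar_eq_one_iff]
      by_contra hms
      exact stdAddChar_ne_of_coprime (hq s t hst) (Or.inl hms) hm
    · rw [hα]; simp
    · rw [hα, hls, hlt]; simp
  · push Not at hl
    obtain ⟨i, hi, j, hj, k, hk, hij, hik, hjk⟩ := Finset.two_lt_card.1 hS
    have hl₁ : l i ≠ 0 ∨ l j ≠ 0 := or_iff_not_imp_left.2 fun h0 => hl i hi j hj hij (not_not.1 h0)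
    have hl₂ : l j ≠ 0 ∨ l k ≠ 0 := or_iff_not_imp_left.2 fun h0 => hl j hj k hk hjk (not_not.1 h0)
    have hl₃ : l k ≠ 0 ∨ l i ≠ 0 :=
      or_iff_not_imp_left.2 fun h0 => hl k hk i hi hik.symm (not_not.1 h0)
    have h₁ := sub_ne_zero.2 (stdAddChar_ne_of_coprime (hq i j hij) hl₁)
    have h₂ := sub_ne_zero.2 (stdAddChar_ne_of_coprime (hq j k hjk) hl₂)
    have h₃ := sub_ne_zero.2 (stdAddChar_ne_of_coprime (hq k i hik.symm) hl₃)
    obtain ⟨x, hx⟩ : ∃ x, x = (ZMod.stdAddChar (l i) : ℂ) := ⟨_, rfl⟩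
    obtain ⟨y, hy⟩ : ∃ y, y = (ZMod.stdAddChar (l j) : ℂ) := ⟨_, rfl⟩
    obtain ⟨w, hw⟩ : ∃ w, w = (ZMod.stdAddChar (l k) : ℂ) := ⟨_, rfl⟩
    rw [← hx, ← hy] at h₁
    rw [← hy, ← hw] at h₂
    rw [← hw, ← hx] at h₃
    have hα : ∀ g : Fin d → ℂ, ∑ n, (Pi.single i (y - w) + Pi.single j (w - x) +
        Pi.single k (x - y) : Fin d → ℂ) n * g n =
        (y - w) * g i + (w - x) * g j + (x - y) * g k := by
      intro g
      simp only [Pi.add_apply, add_mul, Finset.sum_add_distrib, sum_single_mul]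
    have hβ : ∀ g : Fin d → ℂ, ∑ n, (Pi.single i ((1 - y) / (x - y)) +
        Pi.single j ((x - 1) / (x - y)) : Fin d → ℂ) n * g n =
        (1 - y) / (x - y) * g i + (x - 1) / (x - y) * g j := by
      intro g
      simp only [Pi.add_apply, add_mul, Finset.sum_add_distrib, sum_single_mul]
    -- Up to sign, `α` is the cross product of `(1, 1, 1)` and `(x, y, w)`, hence it annihilates the
    -- characters at 0 and at `l`; its three entries are nonzero. The vector `β` solves `βᵢ + βⱼ =
    -- 1` and `βᵢ x + βⱼ y = 1`, the normalisations for the two kinds of bounded index.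
    refine potentialMatrix_apply_eq_zero_of_direction q v hv a S γ hγ h
      (Pi.single i (y - w) + Pi.single j (w - x) + Pi.single k (x - y))
      (Pi.single i ((1 - y) / (x - y)) + Pi.single j ((x - 1) / (x - y))) ?_ ?_ ?_ 0 l ?_ ?_
    · intro n hn
      have h1 : n ≠ i := fun e => hn (e ▸ hi)
      have h2 : n ≠ j := fun e => hn (e ▸ hj)
      have h3 : n ≠ k := fun e => hn (e ▸ hk)
      simp [h1, h2, h3]
    · intro n hn
      by_cases h1 : n = i
      · subst h1
        simp [hij, hik, h₂] at hn
      · by_cases h2 : n = j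
        · subst h2
          simp [hij.symm, hjk, h₃] at hn
        · simp [h1, h2]
    · intro m hm
      rw [hα, hx, hy, hw] at hm
      rw [hβ]
      rcases eq_zero_or_eq_of_collinear (hq i j hij) (hq j k hjk) (hq k i hik.symm) hl₁ hl₂ hl₃ hm
        with ⟨h1, h2⟩ | ⟨h1, h2⟩
      · rw [h1, h2, AddChar.map_zero_eq_one, AddChar.map_zero_eq_one]
        field_simp
        ring
      · rw [h1, h2, ← hx, ← hy]
        field_simp
        ring
    · rw [hα]
      simp only [Pi.zero_apply, AddChar.map_zero_eq_one]
      ring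
    · rw [hα, ← hx, ← hy, ← hw]
      ring

theorem IsGammaPeriodic.add_sum_single {q : Fin d → ℕ} {V : (Fin d → ℤ) → ℝ}
    (hV : IsGammaPeriodic q V) (n c : Fin d → ℤ) :
    V (n + ∑ j, c j • Pi.single j (q j : ℤ)) = V n := by
  let P : AddSubgroup (Fin d → ℤ) :=
    { carrier := {p | ∀ n, V (n + p) = V n}
      zero_mem' := fun n => by rw [add_zero]
      add_mem' := fun {p r} hp hr n => by rw [← add_assoc, hr, hp]
      neg_mem' := fun {p} hp n => by rw [← hp (n + -p), neg_add_cancel_right] }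
  have : ∑ j, c j • (Pi.single j (q j : ℤ) : Fin d → ℤ) ∈ P :=
    P.sum_mem fun j _ => P.zsmul_mem (fun n => hV n j) _
  exact this n

theorem IsGammaPeriodic.apply_cellRep {V : (Fin d → ℤ) → ℝ}
    (hV : IsGammaPeriodic q V) (n : Fin d → ℤ) :
    V (cellRep q fun j => (n j : ZMod (q j))) = V n := by
  rw [← hV.add_sum_single (cellRep q fun j => (n j : ZMod (q j))) fun j => n j / (q j : ℤ)]
  congr 1
  funext i
  simp only [Pi.add_apply, Finset.sum_apply, Pi.smul_apply, smul_eq_mul, cellRep,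
    ZMod.val_intCast, Pi.single_apply, mul_ite, mul_zero, Finset.sum_ite_eq, Finset.mem_univ,
    if_true]
  exact Int.emod_add_ediv_mul _ _

end Rigidity

theorem mainTheorem10 {d : ℕ} (hd : 2 ≤ d) (q : Fin d → ℕ) [∀ j, NeZero (q j)]
    (hq : ∀ i j : Fin d, i ≠ j → Nat.Coprime (q i) (q j))
    (V : (Fin d → ℤ) → ℝ) (hV : IsGammaPeriodic q V)
    (hiso : ∀ s t : Fin d, s < t → ∃ S : Finset (Fin d), s ∈ S ∧ t ∈ S ∧ 3 ≤ S.card ∧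
      PartiallyFermiIsospectral q (fun n => (V n : ℂ)) (fun _ => 0) S) :
    ∀ n : Fin d → ℤ, V n = 0 := by
  -- One set of at least three directions already determines every Fourier coefficient.
  obtain ⟨S, -, -, hS, a, -, kstar, h⟩ :=
    hiso ⟨0, by omega⟩ ⟨1, by omega⟩ (Fin.mk_lt_mk.2 one_pos)
  have hreal : ∀ k : Fin d → ℝ, (∀ j, j ∉ S → k j = kstar j) →
      symbolDet q (fun x => (V (cellRep q x) : ℂ)) a (fun j => floquetMultiplier (q j) (k j)) =
        symbolDet q 0 a fun j => floquetMultiplier (q j) (k j) := by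
    intro k hk
    have := h k hk
    rw [floquetDet_eq, floquetDet_eq] at this
    exact this
  have hzero := eq_zero_of_potentialMatrix_row_zero q _
    (potentialMatrix_zero_apply_eq_zero q hq (fun x => (V (cellRep q x) : ℂ))
      (fun x => Complex.conj_ofReal _) a S hS _ (fun j => floquetMultiplier_ne_zero (q j) (kstar j))
      (symbolDet_eq_of_real q _ 0 a S kstar hreal))
  intro n
  rw [← hV.apply_cellRep q n]
  exact Complex.ofReal_eq_zero.1 <| congrFun hzero fun j => (n j : ZMod (q j))
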